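/- Let $S\subset\mathbb R^d$ be nonempty and closed, and let $\mathrm{usc\text{-}fcns}(S)$ be the set of upper semicontinuous $f:S\to[-\infty,\infty]$ with $f\not\equiv-\infty$. Write $\mathrm{hypo} f=\{(x,\alpha)\in S\times\mathbb R: f(x)\ge\alpha\}$. Fix $\bar c\in S\times\mathbb R$ and equip this set with the aw-distance $$d(f,g)=\int_0^\infty \max_{\|\bar x-\bar c\|\le\rho}\bigl|\mathrm{dist}(\bar x,\mathrm{hypo} f)-\mathrm{dist}(\bar x,\mathrm{hypo} g)\bigr|\,e^{-\rho}\,d\rho ,$$ where $\|(x,\alpha)\|=\max(\|x\|_2,|\alpha|)$ on $\mathbb R^d\times\mathbb R$ (other norms give the same topology). Let $F\subset \mathrm{usc\text{-}fcns}(S)$ be closed, with the topology and Borel $\sigma$-algebra of $d$. Let $S^0\subset\mathbb R^{d_0}$, let $(S^0,\mathcal B,P^0)$ be a complete probability space, and let $X^1,X^2,\dots$ be independent random elements of $(S^0,\mathcal B)$ with distribution $P^0$, defined on a probability space $(\Omega,\mathcal A,\mathbb P)$ and measurable with respect to the $\mathbb P$-completion of $\mathcal A$. (For random vectors with values in $S^0$,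 $\mathcal B$ may be the completion of the Borel $\sigma$-algebra under their law.) Let $\psi:S^0\times F\to[-\infty,\infty]$ be a random lsc function, i.e. $\psi(x,\cdot)$ is lower semicontinuous for every $x\in S^0$ and $\psi$ is measurable for the product $\sigma$-algebra on $S^0\times F$. Suppose that $\psi$ is locally inf-integrable: for every $f\in F$ there is $\rho>0$ such that $\int\inf\{\psi(x,g): g\in F,\ d(f,g)\le\rho\}\,dP^0(x)>-\infty$, in the sense that the negative part of the integrand has finite integral. Let $\pi^n:F\to[0,\infty)$, $n\in\mathbb N$, satisfy $\pi^n(f^n)\to0$ for every sequence $f^n\in F$ that converges in $F$. For $\varepsilon\ge0$ and $\phi:F\to[-\infty,\infty]$ let $\varepsilon\text{-}\mathrm{argmin}_F\,\phi=\{f\in F:\phi(f)\le\inf_F\phi+\varepsilon\}$ and $\mathrm{argmin}_F\,\phi=0\text{-}\mathrm{argmin}_F\,\phi$, with the convention $-\infty+\infty=\infty$ in sums. Set $$\phi^n(f)=\frac1n\sum_{j=1}^n\psi(X^j,f)+\pi^n(f),\qquad \phi(f)=\mathbb E[\psi(X^1,f)].$$ For sets $A^n\subset F$, the outer limit $\mathrm{OutLim}\,A^n$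 is the set of limits of convergent sequences $a^k\in A^{n_k}$ with $n_1<n_2<\cdots$, the inner limit is the set of limits of convergent sequences with $a^n\in A^n$ for all large $n$, and $A^n\to A$ (set-convergence) means that both equal $A$. Then, almost surely, both of the following hold. (i) For every sequence $\varepsilon^n\ge0$ with $\varepsilon^n\to0$, $$\mathrm{OutLim}\bigl(\varepsilon^n\text{-}\mathrm{argmin}_F\,\phi^n\bigr)\subset\mathrm{argmin}_F\,\phi .$$ (ii) If $\phi(f)<\infty$ for at least one $f\in F$, and if there is $(x,\alpha)\in S\times\mathbb R$ such that $f(x)\ge\alpha$ for all $f\in F$, then there is a sequence $\varepsilon^n\ge0$ with $\varepsilon^n\to0$ (which may depend on the realization) such that $$\varepsilon^n\text{-}\mathrm{argmin}_F\,\phi^n\ \to\ \mathrm{argmin}_F\,\phi .$$ -/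

import Mathlib

open MeasureTheory ProbabilityTheory Filter Topology Set
open scoped NNReal ENNReal

/-- `usc-fcns(S)`: the upper semicontinuous functions `S → [-∞, ∞]` that are not identically `-∞`,
where `S ⊆ ℝ^d`.  The point `c ∈ S × ℝ` is the centre of the aw-distance; it is recorded in the type
so that the aw-distance can be made a metric space instance.  It plays no other role. -/
@[ext]
structure UscFcns {d : ℕ} (S : Set (EuclideanSpace ℝ (Fin d))) (c : S × ℝ) where
  toFun : S → EReal
  usc : UpperSemicontinuous toFun
  ne_bot : ∃ x, toFun x ≠ ⊥

namespace UscFcns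

variable {d : ℕ} {S : Set (EuclideanSpace ℝ (Fin d))} {c : S × ℝ}

instance : CoeFun (UscFcns S c) (fun _ => S → EReal) := ⟨toFun⟩

/-- The hypograph `{(x, α) ∈ S × ℝ | f x ≥ α}`, as a subset of `ℝ^d × ℝ`. -/
def hypo (f : UscFcns S c) : Set (EuclideanSpace ℝ (Fin d) × ℝ) :=
  {p | ∃ h : p.1 ∈ S, (p.2 : EReal) ≤ f ⟨p.1, h⟩}

/-- The centre of the aw-distance as a point of `ℝ^d × ℝ`. -/
def centre (c : S × ℝ) : EuclideanSpace ℝ (Fin d) × ℝ := ((c.1 : EuclideanSpace ℝ (Fin d)), c.2)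

/-- The `ρ`-aw-distance
`max { |dist(x̄, hypo f) - dist(x̄, hypo g)| : ‖x̄ - centre‖ ≤ ρ }`, for the norm
`‖(x, α)‖ = max (‖x‖₂, |α|)` on `ℝ^d × ℝ`. -/
noncomputable def rhoDist (ρ : ℝ) (f g : UscFcns S c) : ℝ :=
  ⨆ p : Metric.closedBall (centre c) ρ,
    |Metric.infDist (p : EuclideanSpace ℝ (Fin d) × ℝ) f.hypo - Metric.infDist p.1 g.hypo|

/-- The aw-distance `∫₀^∞ rhoDist ρ f g * e^{-ρ} dρ`. -/
noncomputable def awDist (f g : UscFcns S c) : ℝ :=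
  ∫ ρ in Ioi (0 : ℝ), rhoDist ρ f g * Real.exp (-ρ)

theorem hypo_nonempty (f : UscFcns S c) : f.hypo.Nonempty := by
  obtain ⟨x, hx⟩ := f.ne_bot
  obtain ⟨r, -, hr⟩ := EReal.lt_iff_exists_real_btwn.1 (bot_lt_iff_ne_bot.2 hx)
  exact ⟨((x : EuclideanSpace ℝ (Fin d)), r), x.2, hr.le⟩

theorem mem_hypo_of_mem_closure (f : UscFcns S c) {p : EuclideanSpace ℝ (Fin d) × ℝ}
    (hp : p ∈ closure f.hypo) (hS : p.1 ∈ S) : p ∈ f.hypo := by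
  refine ⟨hS, ?_⟩
  by_contra hlt
  rw [not_le] at hlt
  obtain ⟨y, hy1, hy2⟩ := EReal.lt_iff_exists_real_btwn.1 hlt
  have h1 := f.usc ⟨p.1, hS⟩ y hy1
  rw [nhds_subtype_eq_comap, eventually_comap] at h1
  have h2 : ∀ᶠ q in 𝓝 p, ∀ b : S, (b : EuclideanSpace ℝ (Fin d)) = q.1 → f b < y :=
    (continuous_fst.tendsto p).eventually h1
  have h3 : ∀ᶠ q in 𝓝 p, y < q.2 :=
    (continuous_snd.tendsto p).eventually (lt_mem_nhds (EReal.coe_lt_coe_iff.1 hy2))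
  obtain ⟨q, ⟨hA, hle⟩, hq, hq'⟩ :=
    ((mem_closure_iff_frequently.1 hp).and_eventually (h2.and h3)).exists
  exact absurd (hle.trans_lt (hq ⟨q.1, hA⟩ rfl)) (not_lt.2 (EReal.coe_le_coe_iff.2 hq'.le))

theorem abs_sub_infDist_le (f g : UscFcns S c) {ρ : ℝ} (p : Metric.closedBall (centre c) ρ) :
    |Metric.infDist p.1 f.hypo - Metric.infDist p.1 g.hypo| ≤
      (Metric.infDist (centre c) f.hypo + Metric.infDist (centre c) g.hypo) + ρ := by
  have hp : dist p.1 (centre c) ≤ ρ := p.2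
  have h1 := Metric.infDist_le_infDist_add_dist (x := p.1) (y := centre c) (s := f.hypo)
  have h2 := Metric.infDist_le_infDist_add_dist (x := p.1) (y := centre c) (s := g.hypo)
  have h3 := Metric.infDist_nonneg (x := p.1) (s := f.hypo)
  have h4 := Metric.infDist_nonneg (x := p.1) (s := g.hypo)
  have h5 := Metric.infDist_nonneg (x := centre c) (s := f.hypo)
  have h6 := Metric.infDist_nonneg (x := centre c) (s := g.hypo)
  rw [abs_le]
  constructor <;> linarith

theorem bddAbove_rhoDist (ρ : ℝ) (f g : UscFcns S c) :
    BddAbove (range fun p : Metric.closedBall (centre c) ρ =>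
      |Metric.infDist p.1 f.hypo - Metric.infDist p.1 g.hypo|) :=
  ⟨_, forall_mem_range.2 fun p => abs_sub_infDist_le f g p⟩

theorem rhoDist_nonneg (ρ : ℝ) (f g : UscFcns S c) : 0 ≤ rhoDist ρ f g :=
  Real.iSup_nonneg fun _ => abs_nonneg _

theorem rhoDist_mono (f g : UscFcns S c) : Monotone fun ρ => rhoDist ρ f g := by
  intro a b hab
  refine Real.iSup_le (fun p => ?_) (rhoDist_nonneg _ _ _)
  exact le_ciSup (bddAbove_rhoDist b f g) ⟨p.1, Metric.closedBall_subset_closedBall hab p.2⟩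

theorem rhoDist_le {ρ : ℝ} (hρ : 0 ≤ ρ) (f g : UscFcns S c) : rhoDist ρ f g ≤
    (Metric.infDist (centre c) f.hypo + Metric.infDist (centre c) g.hypo) + ρ :=
  Real.iSup_le (fun p => abs_sub_infDist_le f g p)
    (add_nonneg (add_nonneg Metric.infDist_nonneg Metric.infDist_nonneg) hρ)

theorem rhoDist_triangle (ρ : ℝ) (f g h : UscFcns S c) :
    rhoDist ρ f h ≤ rhoDist ρ f g + rhoDist ρ g h := by
  refine Real.iSup_le (fun p => ?_) (add_nonneg (rhoDist_nonneg _ _ _) (rhoDist_nonneg _ _ _))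
  exact (abs_sub_le _ _ _).trans
    (add_le_add (le_ciSup (bddAbove_rhoDist ρ f g) p) (le_ciSup (bddAbove_rhoDist ρ g h) p))

theorem integrableOn_rhoDist (f g : UscFcns S c) :
    IntegrableOn (fun ρ => rhoDist ρ f g * Real.exp (-ρ)) (Ioi 0) := by
  set K := Metric.infDist (centre c) f.hypo + Metric.infDist (centre c) g.hypo with hK
  have hK0 : 0 ≤ K := add_nonneg Metric.infDist_nonneg Metric.infDist_nonneg
  have hint : IntegrableOn (fun ρ : ℝ => (K + 2) * Real.exp (-(1 / 2) * ρ)) (Ioi 0) :=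
    (exp_neg_integrableOn_Ioi 0 (by norm_num)).const_mul _
  refine Integrable.mono' hint ?_ ?_
  · exact (((rhoDist_mono f g).measurable).mul (by fun_prop)).aestronglyMeasurable
  · refine (ae_restrict_iff' measurableSet_Ioi).2 (Eventually.of_forall fun ρ hρ => ?_)
    have hρ' : (0 : ℝ) < ρ := hρ
    rw [Real.norm_eq_abs, abs_of_nonneg (mul_nonneg (rhoDist_nonneg _ _ _) (Real.exp_pos _).le)]
    have h1 : rhoDist ρ f g ≤ K + ρ := rhoDist_le hρ'.le f g
    have h2 : ρ / 2 + 1 ≤ Real.exp (ρ / 2) := Real.add_one_le_exp _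
    have h3 : Real.exp (-(1 / 2) * ρ) = Real.exp (ρ / 2) * Real.exp (-ρ) := by
      rw [← Real.exp_add]; ring_nf
    rw [h3, ← mul_assoc]
    refine mul_le_mul_of_nonneg_right ?_ (Real.exp_pos _).le
    nlinarith

/-- `usc-fcns(S)` is a metric space under the aw-distance. -/
noncomputable instance : MetricSpace (UscFcns S c) where
  dist := awDist
  dist_self f := by simp [awDist, rhoDist]
  dist_comm f g := by simp only [awDist, rhoDist, abs_sub_comm]
  dist_triangle f g h := by
    unfold awDist
    rw [← integral_add (integrableOn_rhoDist f g) (integrableOn_rhoDist g h)]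
    refine integral_mono (integrableOn_rhoDist f h)
      ((integrableOn_rhoDist f g).add (integrableOn_rhoDist g h)) fun ρ => ?_
    simp only [← add_mul]
    exact mul_le_mul_of_nonneg_right (rhoDist_triangle ρ f g h) (Real.exp_pos _).le
  eq_of_dist_eq_zero := by
    intro f g hfg
    have h0 : (fun ρ => rhoDist ρ f g * Real.exp (-ρ)) =ᵐ[volume.restrict (Ioi 0)] 0 :=
      (setIntegral_eq_zero_iff_of_nonneg_ae (Eventually.of_forall fun ρ =>
        mul_nonneg (rhoDist_nonneg _ _ _) (Real.exp_pos _).le) (integrableOn_rhoDist f g)).1 hfg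
    rw [EventuallyEq, ae_restrict_iff' measurableSet_Ioi] at h0
    have hz : ∀ ρ, rhoDist ρ f g = 0 := by
      intro ρ
      have hfr : ∃ r ∈ Ioi (max ρ 0), rhoDist r f g = 0 := by
        by_contra hcon
        push Not at hcon
        have : volume (Ioi (max ρ 0)) = 0 := by
          refine measure_mono_null (fun r hr => ?_) h0
          simp only [mem_compl_iff, mem_ofPred_eq, Classical.not_imp]
          refine ⟨mem_Ioi.2 (lt_of_le_of_lt (le_max_right ρ 0) (mem_Ioi.1 hr)), ?_⟩
          exact mul_ne_zero (hcon r hr) (Real.exp_pos _).ne'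
        simp at this
      obtain ⟨r, hr, hr0⟩ := hfr
      exact le_antisymm (hr0 ▸ rhoDist_mono f g ((le_max_left ρ 0).trans (le_of_lt hr)))
        (rhoDist_nonneg _ _ _)
    have heq : ∀ p, Metric.infDist p f.hypo = Metric.infDist p g.hypo := by
      intro p
      have h1 := le_ciSup (bddAbove_rhoDist (dist p (centre c)) f g) ⟨p, Metric.mem_closedBall.2 le_rfl⟩
      have h2 := h1.trans_eq (hz _)
      exact sub_eq_zero.1 (abs_eq_zero.1 (le_antisymm h2 (abs_nonneg _)))
    have hsub : ∀ a b : UscFcns S c, (∀ p, Metric.infDist p a.hypo = Metric.infDist p b.hypo) →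
        ∀ x, a x ≤ b x := by
      intro a b hab x
      by_contra hlt
      rw [not_le] at hlt
      obtain ⟨y, hy1, hy2⟩ := EReal.lt_iff_exists_real_btwn.1 hlt
      have hm : ((x : EuclideanSpace ℝ (Fin d)), y) ∈ a.hypo := ⟨x.2, hy2.le⟩
      have hm' : ((x : EuclideanSpace ℝ (Fin d)), y) ∈ b.hypo := by
        refine mem_hypo_of_mem_closure b ?_ x.2
        rw [Metric.mem_closure_iff_infDist_zero b.hypo_nonempty, ← hab,
          ← Metric.mem_closure_iff_infDist_zero a.hypo_nonempty]
        exact subset_closure hm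
      obtain ⟨_, hle⟩ := hm'
      exact absurd hy1 (not_lt.2 hle)
    exact UscFcns.ext (funext fun x =>
      le_antisymm (hsub f g heq x) (hsub g f (fun p => (heq p).symm) x))

/-- The Borel sigma-algebra of the aw-distance. -/
noncomputable instance : MeasurableSpace (UscFcns S c) := borel _

instance : BorelSpace (UscFcns S c) := ⟨rfl⟩

end UscFcns

/-- Outer limit: the points to which some subsequence `a (n k) ∈ A (n k)` converges. -/
def OutLim {Y : Type*} [TopologicalSpace Y] (A : ℕ → Set Y) : Set Y :=
  {y | ∃ (k : ℕ → ℕ) (a : ℕ → Y), StrictMono k ∧ (∀ i, a i ∈ A (k i)) ∧ Tendsto a atTop (𝓝 y)}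

/-- Inner limit: the points to which some sequence with `a n ∈ A n` (for all large `n`) converges. -/
def InnLim {Y : Type*} [TopologicalSpace Y] (A : ℕ → Set Y) : Set Y :=
  {y | ∃ a : ℕ → Y, (∀ᶠ n in atTop, a n ∈ A n) ∧ Tendsto a atTop (𝓝 y)}

/-- `A n` set-converges to `B`. -/
def SetConverges {Y : Type*} [TopologicalSpace Y] (A : ℕ → Set Y) (B : Set Y) : Prop :=
  OutLim A = B ∧ InnLim A = B

/-- `ε-argmin φ = {f | φ f ≤ inf φ + ε}`. -/
def epsArgmin {Y : Type*} (ε : ℝ) (φ : Y → EReal) : Set Y :=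
  {f | φ f ≤ (⨅ g, φ g) + (ε : EReal)}

/-- `argmin φ = {f | φ f ≤ inf φ}`. -/
def argmin {Y : Type*} (φ : Y → EReal) : Set Y :=
  {f | φ f ≤ ⨅ g, φ g}

/-- The integral `∫ h⁺ - ∫ h⁻` of an extended real-valued function, with `∞ - ∞ = ∞`
(in `EReal`, `⊤ - ⊤ = ⊥`, whence the two negations). -/
noncomputable def extIntegral {Ω : Type*} [MeasurableSpace Ω] (μ : Measure Ω) (h : Ω → EReal) :
    EReal :=
  -(((∫⁻ ω, (-h ω).toENNReal ∂μ : ℝ≥0∞) : EReal) - ((∫⁻ ω, (h ω).toENNReal ∂μ : ℝ≥0∞) : EReal))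

/-- Finite sums in `[-∞, ∞]` with the convention `-∞ + ∞ = ∞`
(in `EReal`, `⊥ + ⊤ = ⊥`, whence the two negations). -/
noncomputable def extSum {ι : Type*} (s : Finset ι) (a : ι → EReal) : EReal :=
  -∑ j ∈ s, -a j

/-- Random lsc function: lsc in the second argument, and measurable for the product of the given
sigma-algebra and the Borel sigma-algebra. -/
def IsRandomLsc {Ξ Y : Type*} [MeasurableSpace Ξ] [TopologicalSpace Y] [MeasurableSpace Y]
    (ψ : Ξ → Y → EReal) : Prop :=
  (∀ x, LowerSemicontinuous (ψ x)) ∧ Measurable (Function.uncurry ψ)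

/-- Local inf-integrability: every `f` has a closed ball over which the infimum of `ψ x` has an
integral greater than `-∞`, i.e. a negative part with finite integral. -/
def LocallyInfIntegrable {Ξ Y : Type*} [MeasurableSpace Ξ] [PseudoMetricSpace Y] (P : Measure Ξ)
    (ψ : Ξ → Y → EReal) : Prop :=
  ∀ f : Y, ∃ ρ : ℝ, 0 < ρ ∧
    ∫⁻ x, (-(⨅ (g : Y) (_ : dist f g ≤ ρ), ψ x g)).toENNReal ∂P < ⊤

/-- `X 0, X 1, …` are independent random elements, each with distribution `P`.  Measurability is
required up to `μ`-null sets, i.e. for the `μ`-completion of the sigma-algebra of `Ω`. -/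
def IsIIDSample {Ω Ξ : Type*} [MeasurableSpace Ω] [MeasurableSpace Ξ] (μ : Measure Ω)
    (P : Measure Ξ) (X : ℕ → Ω → Ξ) : Prop :=
  (∀ j, NullMeasurable (X j) μ) ∧ (∀ j A, MeasurableSet A → μ (X j ⁻¹' A) = P A) ∧ iIndepFun X μ

/-- The penalized empirical risk `n⁻¹ ∑_{j<n} ψ (x j) f + pen n f`, used for `n ≥ 1`; the data
points are numbered from `0`. -/
noncomputable def penalizedRisk {Ξ Y : Type*} (ψ : Ξ → Y → EReal) (pen : ℕ → Y → ℝ≥0)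
    (x : ℕ → Ξ) (n : ℕ) (f : Y) : EReal :=
  (((n : ℝ)⁻¹ : ℝ) : EReal) * extSum (Finset.range n) (fun j => ψ (x j) f) +
    ((pen n f : ℝ) : EReal)

/-! The proof establishes enough epi-convergence of the empirical risks, with the exceptional null
sets reduced to countably many uses of the strong law of large numbers.

Lower half: for open `U` and `m : ℕ`, the truncated infimum `min (⨅ g ∈ U, ψ x g) m` is measurable
in `x`, by measurable projection and completeness of `P₀`. As `U` shrinks to `f` and `m` grows, it
increases to `ψ x f` by lower semicontinuity. Local inf-integrability supplies the minorant for
monotone convergence, so its expectation increases to that of `ψ x f`. The strong law for the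
countably many pairs of a basic `U` and an `m` then bounds the risks from below near every `f`
simultaneously; a nonnegative penalty only helps.

Upper half: pointwise convergence is needed only on a countable set `D` that approaches the infimum
of the limit risk and is dense among its minimizers. The two halves give (i).

For (ii), a common minorant makes `F` compact, so the infima converge if `D` contains a minimizer.
The gaps between the empirical risk at a minimizer in `D` and the empirical infimum are then
countably many null sequences, and one null sequence eventually dominates each of them.

The projection theorem needs `F` Polish. Ultrafilter limits of distance functions to hypographs are
again distance functions to hypographs, and their pointwise convergence implies aw-convergence;
hence closed balls are compact. -/

namespace MeasureTheory

/-! ### Analytic sets and measurable projection. -/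

/-- Inner regularity of a finite measure on analytic sets, with respect to compact sets. -/
theorem AnalyticSet.exists_isCompact_le_measure {α : Type*} [TopologicalSpace α]
    [TopologicalSpace.MetrizableSpace α] [MeasurableSpace α] [BorelSpace α] (μ : Measure α)
    [IsFiniteMeasure μ] {s : Set α} (hs : AnalyticSet s) {c : ℝ≥0∞} (hc : c < μ s) :
    ∃ K ⊆ s, IsCompact K ∧ c ≤ μ K := by
  let _ := TopologicalSpace.metrizableSpaceMetric α
  rw [AnalyticSet] at hs
  rcases hs with rfl | ⟨f, hf, rfl⟩
  · simp at hc
  -- Bound the coordinates of Baire space one at a time, keeping the measure of the image above `c`.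
  -- Continuity from below along increasing unions needs no measurability of the images.
  have step : ∀ (k : ℕ) (D : {D : Set (ℕ → ℕ) // c < μ (f '' D)}),
      ∃ m : ℕ, c < μ (f '' (D.1 ∩ {σ | σ k ≤ m})) := by
    intro k D
    have h1 : f '' D.1 = ⋃ m : ℕ, f '' (D.1 ∩ {σ | σ k ≤ m}) := by
      rw [← image_iUnion, ← inter_iUnion]
      congr 1
      ext σ
      simp only [mem_inter_iff, mem_iUnion, mem_ofPred_eq, iff_self_and]
      exact fun _ => ⟨_, le_rfl⟩
    have h2 : Monotone fun m : ℕ => f '' (D.1 ∩ {σ | σ k ≤ m}) := fun a b hab =>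
      image_mono fun σ hσ => ⟨hσ.1, le_trans hσ.2 hab⟩
    have h3 := D.2
    rw [h1, h2.directed_le.measure_iUnion] at h3
    exact lt_iSup_iff.1 h3
  choose m hm using step
  let D : ℕ → {D : Set (ℕ → ℕ) // c < μ (f '' D)} := fun k =>
    Nat.rec ⟨univ, by rwa [image_univ]⟩ (fun k D => ⟨D.1 ∩ {σ | σ k ≤ m k D}, hm k D⟩) k
  set n : ℕ → ℕ := fun k => m k (D k) with hn
  have hD : ∀ k, (D k).1 = {σ | ∀ i < k, σ i ≤ n i} := by
    intro k
    induction k with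
    | zero => ext; simp [D]
    | succ k ih =>
      have : (D (k + 1)).1 = (D k).1 ∩ {σ | σ k ≤ n k} := rfl
      rw [this, ih]
      ext σ
      simp only [mem_inter_iff, mem_ofPred_eq, Nat.lt_succ_iff_lt_or_eq]
      constructor
      · rintro ⟨h1, h2⟩ i (hi | rfl)
        · exact h1 i hi
        · exact h2
      · exact fun h => ⟨fun i hi => h i (Or.inl hi), h k (Or.inr rfl)⟩
  have hC : IsCompact (Set.pi univ fun i => Iic (n i)) :=
    isCompact_univ_pi fun i => (finite_Iic _).isCompact
  have hK := hC.image hf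
  refine ⟨_, image_subset_range _ _, hK, ?_⟩
  have hsub : ⋂ k, closure (f '' (D k).1) ⊆ f '' (Set.pi univ fun i => Iic (n i)) := by
    intro y hy
    have h1 : ∀ k : ℕ, ∃ σ ∈ (D k).1, dist y (f σ) < 1 / ((k : ℝ) + 1) := by
      intro k
      obtain ⟨_, ⟨σ, hσ, rfl⟩, h⟩ :=
        Metric.mem_closure_iff.1 (mem_iInter.1 hy k) _ (Nat.one_div_pos_of_nat (n := k))
      exact ⟨σ, hσ, h⟩
    choose σ hσ hd using h1
    -- Only the first `k` coordinates of `σ k` are bounded, so truncate the others to land in the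
    -- compact box; each fixed coordinate is unchanged for large `k`.
    obtain ⟨τ, hτ, φ, hφ, hlim⟩ := hC.tendsto_subseq
      (x := fun k i => min (σ k i) (n i)) (fun k i _ => mem_Iic.2 (min_le_right _ _))
    have h2 : Tendsto (σ ∘ φ) atTop (𝓝 τ) := by
      rw [tendsto_pi_nhds] at hlim ⊢
      intro i
      refine (hlim i).congr' ?_
      filter_upwards [eventually_gt_atTop i] with k hk
      have h3 := hσ (φ k)
      rw [hD] at h3
      exact min_eq_left (h3 i (hk.trans_le (hφ.id_le k)))
    have h4 : Tendsto (fun k => f (σ (φ k))) atTop (𝓝 y) := by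
      rw [tendsto_iff_dist_tendsto_zero]
      refine squeeze_zero (fun _ => dist_nonneg) (fun k => ?_)
        (tendsto_one_div_add_atTop_nhds_zero_nat.comp hφ.tendsto_atTop)
      rw [dist_comm]
      exact (hd _).le
    exact ⟨τ, hτ, tendsto_nhds_unique ((hf.tendsto τ).comp h2) h4⟩
  have hanti : Antitone fun k => closure (f '' (D k).1) := by
    refine antitone_nat_of_succ_le fun k => closure_mono (image_mono ?_)
    exact inter_subset_left
  refine le_trans ?_ (measure_mono hsub)
  rw [hanti.measure_iInter (fun k => isClosed_closure.measurableSet.nullMeasurableSet)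
    ⟨0, measure_ne_top _ _⟩]
  exact le_iInf fun k => (D k).2.le.trans (measure_mono subset_closure)

/-- Analytic sets are universally measurable. -/
theorem AnalyticSet.nullMeasurableSet {α : Type*} [TopologicalSpace α]
    [TopologicalSpace.MetrizableSpace α] [MeasurableSpace α] [BorelSpace α] (μ : Measure α)
    [IsFiniteMeasure μ] {s : Set α} (hs : AnalyticSet s) : NullMeasurableSet s μ := by
  rcases eq_or_ne (μ s) 0 with h0 | h0
  · exact NullMeasurableSet.of_null h0
  obtain ⟨u, -, hu, hlim⟩ := exists_seq_strictMono_tendsto' (pos_iff_ne_zero.2 h0)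
  choose K hKs hK hle using fun n => hs.exists_isCompact_le_measure μ (hu n).2
  have hm : MeasurableSet (⋃ n, K n) := MeasurableSet.iUnion fun n => (hK n).isClosed.measurableSet
  have h1 : μ s ≤ μ (⋃ n, K n) :=
    le_of_tendsto' hlim fun n => (hle n).trans (measure_mono (subset_iUnion K n))
  exact hm.nullMeasurableSet.congr
    (ae_eq_of_subset_of_measure_ge (iUnion_subset hKs) h1 hm.nullMeasurableSet (measure_ne_top _ _))

/-- A measurable subset of a product is pulled back from a product with the Cantor space. -/
theorem exists_measurable_preimage_prodMap {Ξ Y : Type*} [MeasurableSpace Ξ] [MeasurableSpace Y]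
    {M : Set (Ξ × Y)} (hM : MeasurableSet M) :
    ∃ (h : Ξ → ℕ → Bool) (N : Set ((ℕ → Bool) × Y)), Measurable h ∧ MeasurableSet N ∧
      M = {p | (h p.1, p.2) ∈ N} := by
  classical
  rw [generateFrom_prod.symm] at hM
  induction M, hM using MeasurableSpace.generateFrom_induction with
  | hC M hM _ =>
    obtain ⟨A, hA, C, hC, rfl⟩ := hM
    refine ⟨fun x _ => decide (x ∈ A), {p | p.1 0 = true ∧ p.2 ∈ C}, ?_, ?_, ?_⟩
    · refine measurable_pi_lambda _ fun _ => measurable_to_bool ?_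
      convert (show MeasurableSet A from hA) using 1
      ext x
      simp
    · refine MeasurableSet.inter ?_ (measurable_snd hC)
      have h0 : Measurable fun p : (ℕ → Bool) × Y => p.1 0 :=
        (measurable_pi_apply 0).comp measurable_fst
      exact h0 (measurableSet_singleton true)
    · ext p
      simp [mem_prod]
  | empty => exact ⟨fun _ _ => true, ∅, measurable_const, MeasurableSet.empty, by simp⟩
  | compl M _ ih =>
    obtain ⟨h, N, hh, hN, rfl⟩ := ih
    exact ⟨h, Nᶜ, hh, hN.compl, rfl⟩
  | iUnion M _ ih =>
    choose h N hh hN hM using ih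
    -- Interleave countably many codes into one through the pairing of `ℕ × ℕ` with `ℕ`.
    refine ⟨fun x k => h k.unpair.1 x k.unpair.2,
      ⋃ n, (fun p => (fun k => p.1 (Nat.pair n k), p.2)) ⁻¹' N n, ?_, ?_, ?_⟩
    · exact measurable_pi_lambda _ fun k => (measurable_pi_apply _).comp (hh _)
    · refine MeasurableSet.iUnion fun n => Measurable.prodMk ?_ measurable_snd (hN n)
      exact measurable_pi_lambda _ fun k => (measurable_pi_apply _).comp measurable_fst
    · ext p
      simp only [mem_iUnion, mem_ofPred_eq, mem_preimage, Nat.unpair_pair]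
      exact exists_congr fun n => by rw [hM n]; rfl

/-- The measurable projection theorem. -/
theorem nullMeasurableSet_image_fst {Ξ Y : Type*} [MeasurableSpace Ξ] [TopologicalSpace Y]
    [PolishSpace Y] [MeasurableSpace Y] [BorelSpace Y] (P : Measure Ξ) [IsFiniteMeasure P]
    {M : Set (Ξ × Y)} (hM : MeasurableSet M) : NullMeasurableSet (Prod.fst '' M) P := by
  obtain ⟨h, N, hh, hN, rfl⟩ := exists_measurable_preimage_prodMap hM
  have h1 : AnalyticSet (Prod.fst '' N) := hN.analyticSet_image measurable_fst
  -- `Ξ` carries no topology: universal measurability is applied in Cantor space to the law of `h`,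
  -- then pulled back.
  have h2 := (h1.nullMeasurableSet (P.map h)).preimage
    (Measure.QuasiMeasurePreserving.mk hh Measure.AbsolutelyContinuous.rfl)
  convert h2 using 1
  ext x
  constructor
  · rintro ⟨p, hp, rfl⟩
    exact ⟨_, hp, rfl⟩
  · rintro ⟨⟨z, y⟩, hp, hz⟩
    exact ⟨(x, y), by simpa [← hz] using hp, rfl⟩

/-- The infimal values of a jointly measurable function over a measurable set are measurable,
if the measure is complete. -/
theorem measurable_biInf_of_measurable_uncurry {Ξ Y : Type*} [MeasurableSpace Ξ]
    [TopologicalSpace Y] [PolishSpace Y] [MeasurableSpace Y] [BorelSpace Y] (P : Measure Ξ)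
    [IsFiniteMeasure P] [P.IsComplete] {ψ : Ξ → Y → EReal}
    (hψ : Measurable (Function.uncurry ψ)) {U : Set Y} (hU : MeasurableSet U) :
    Measurable fun x => ⨅ g ∈ U, ψ x g := by
  refine measurable_of_Iio fun a => ?_
  have hM : MeasurableSet {p : Ξ × Y | p.2 ∈ U ∧ Function.uncurry ψ p < a} :=
    (measurable_snd hU).inter (measurableSet_lt hψ measurable_const)
  convert (nullMeasurableSet_image_fst P hM).measurable_of_complete using 1
  ext x
  simp only [mem_preimage, mem_Iio, iInf_lt_iff, mem_image, Prod.exists, exists_and_right,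
    exists_eq_right, mem_ofPred_eq, Function.uncurry_apply_pair, exists_prop]

end MeasureTheory

/-! ### Compactness in the aw-topology. -/

namespace UscFcns

variable {d : ℕ} {S : Set (EuclideanSpace ℝ (Fin d))} {c : S × ℝ}

theorem isClosed_hypo (hS : IsClosed S) (f : UscFcns S c) : IsClosed f.hypo := by
  refine isClosed_of_closure_subset fun p hp => mem_hypo_of_mem_closure f hp ?_
  have h : f.hypo ⊆ Prod.fst ⁻¹' S := fun q hq => hq.1
  exact closure_minimal h (hS.preimage continuous_fst) hp

/-- A nonempty closed subset of `S × ℝ` that is closed downwards is a hypograph. -/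
theorem exists_hypo_eq {H : Set (EuclideanSpace ℝ (Fin d) × ℝ)} (hc : IsClosed H)
    (hne : H.Nonempty) (hHS : ∀ p ∈ H, p.1 ∈ S)
    (hdown : ∀ (x : EuclideanSpace ℝ (Fin d)) (a b : ℝ), (x, a) ∈ H → b ≤ a → (x, b) ∈ H) :
    ∃ g : UscFcns S c, g.hypo = H := by
  set u : S → EReal := fun x => ⨆ (a : ℝ) (_ : ((x : EuclideanSpace ℝ (Fin d)), a) ∈ H), (a : EReal)
    with hu
  have key : ∀ (x : S) (a : ℝ), (a : EReal) ≤ u x ↔ ((x : EuclideanSpace ℝ (Fin d)), a) ∈ H := by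
    intro x a
    constructor
    · intro h
      have h1 : ∀ b : ℝ, b < a → ((x : EuclideanSpace ℝ (Fin d)), b) ∈ H := by
        intro b hb
        have h2 : (b : EReal) < u x := (EReal.coe_lt_coe_iff.2 hb).trans_le h
        simp only [hu, lt_iSup_iff] at h2
        obtain ⟨a', ha', hlt⟩ := h2
        exact hdown _ _ _ ha' (EReal.coe_lt_coe_iff.1 hlt).le
      have h3 : Tendsto (fun b : ℝ => ((x : EuclideanSpace ℝ (Fin d)), b)) (𝓝[<] a)
          (𝓝 ((x : EuclideanSpace ℝ (Fin d)), a)) :=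
        ((Continuous.prodMk_right _).tendsto a).mono_left nhdsWithin_le_nhds
      exact hc.mem_of_tendsto h3 (eventually_nhdsWithin_of_forall h1)
    · exact fun h => le_iSup₂_of_le a h le_rfl
  refine ⟨⟨u, ?_, ?_⟩, ?_⟩
  · intro x y hxy
    obtain ⟨r, hr1, hr2⟩ := EReal.lt_iff_exists_real_btwn.1 hxy
    have h1 : ((x : EuclideanSpace ℝ (Fin d)), r) ∉ H := fun h => absurd ((key x r).2 h) hr1.not_ge
    have h2 : Continuous fun x' : S => ((x' : EuclideanSpace ℝ (Fin d)), r) :=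
      continuous_subtype_val.prodMk continuous_const
    filter_upwards [h2.tendsto x (hc.isOpen_compl.mem_nhds h1)] with x' hx'
    exact (not_le.1 fun h => hx' ((key x' r).1 h)).trans hr2
  · obtain ⟨p, hp⟩ := hne
    refine ⟨⟨p.1, hHS p hp⟩, fun h => ?_⟩
    have := (key ⟨p.1, hHS p hp⟩ p.2).2 hp
    rw [h] at this
    exact EReal.coe_ne_bot _ (le_bot_iff.1 this)
  · ext p
    exact ⟨fun ⟨h, hp⟩ => (key ⟨p.1, h⟩ p.2).1 hp, fun hp => ⟨hHS p hp, (key ⟨p.1, hHS p hp⟩ p.2).2 hp⟩⟩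

theorem integrableOn_const_mul_exp_neg (K : ℝ) :
    IntegrableOn (fun ρ : ℝ => K * Real.exp (-ρ)) (Ioi 0) := by
  have h := (exp_neg_integrableOn_Ioi (0 : ℝ) one_pos).const_mul K
  simp only [neg_mul, one_mul] at h
  exact h

/-- The centre lies in every ball of the integrand, and `e^{-ρ}` has total mass 1. -/
theorem abs_infDist_centre_sub_le (f g : UscFcns S c) :
    |Metric.infDist (centre c) f.hypo - Metric.infDist (centre c) g.hypo| ≤ dist f g := by
  set K := |Metric.infDist (centre c) f.hypo - Metric.infDist (centre c) g.hypo|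
  have h1 : ∫ ρ in Ioi (0 : ℝ), K * Real.exp (-ρ) = K := by
    rw [integral_const_mul, integral_exp_neg_Ioi_zero, mul_one]
  rw [← h1]
  refine setIntegral_mono_on ?_ (integrableOn_rhoDist f g) measurableSet_Ioi fun ρ hρ => ?_
  · exact integrableOn_const_mul_exp_neg K
  · refine mul_le_mul_of_nonneg_right ?_ (Real.exp_pos _).le
    exact le_ciSup (bddAbove_rhoDist ρ f g) ⟨centre c, Metric.mem_closedBall_self (le_of_lt hρ)⟩

/-- Split the integral at `T`. Below, `rhoDist` is monotone. Above, linear growth gives an integrand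
at most `(K + 2) e^{-ρ/2}`, hence at most `(K + 2) e^{-T/4} e^{-ρ/4}`; the 4 is the integral of
`e^{-ρ/4}`. -/
theorem dist_le_rhoDist_add (T : ℝ) (f g : UscFcns S c) :
    dist f g ≤ rhoDist T f g +
      (Metric.infDist (centre c) f.hypo + Metric.infDist (centre c) g.hypo + 2) *
        (4 * Real.exp (-(T / 4))) := by
  set K := Metric.infDist (centre c) f.hypo + Metric.infDist (centre c) g.hypo with hK
  have hK0 : 0 ≤ K := add_nonneg Metric.infDist_nonneg Metric.infDist_nonneg
  have hi1 : IntegrableOn (fun ρ : ℝ => rhoDist T f g * Real.exp (-ρ)) (Ioi 0) :=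
    integrableOn_const_mul_exp_neg _
  have hi2 : IntegrableOn
      (fun ρ : ℝ => ((K + 2) * Real.exp (-(T / 4))) * Real.exp (-(1 / 4) * ρ)) (Ioi 0) :=
    (exp_neg_integrableOn_Ioi 0 (by norm_num)).const_mul _
  have h1 : ∫ ρ in Ioi (0 : ℝ), (rhoDist T f g * Real.exp (-ρ) +
      ((K + 2) * Real.exp (-(T / 4))) * Real.exp (-(1 / 4) * ρ)) =
      rhoDist T f g + (K + 2) * (4 * Real.exp (-(T / 4))) := by
    rw [integral_add hi1 hi2, integral_const_mul, integral_const_mul, integral_exp_neg_Ioi_zero,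
      integral_exp_mul_Ioi (by norm_num) 0]
    norm_num
    ring
  rw [← h1]
  refine setIntegral_mono_on (integrableOn_rhoDist f g) (hi1.add hi2) measurableSet_Ioi
    fun ρ hρ => ?_
  have hρ' : (0 : ℝ) < ρ := hρ
  rcases le_total ρ T with h | h
  · have h2 := mul_le_mul_of_nonneg_right (rhoDist_mono f g h) (Real.exp_pos (-ρ)).le
    have h3 : 0 ≤ ((K + 2) * Real.exp (-(T / 4))) * Real.exp (-(1 / 4) * ρ) := by positivity
    simp only at h2
    linarith
  · have h2 : 0 ≤ rhoDist T f g * Real.exp (-ρ) :=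
      mul_nonneg (rhoDist_nonneg _ _ _) (Real.exp_pos _).le
    have h3 : rhoDist ρ f g ≤ K + ρ := rhoDist_le hρ'.le f g
    have h4 : ρ / 2 + 1 ≤ Real.exp (ρ / 2) := Real.add_one_le_exp _
    have h5 : rhoDist ρ f g ≤ (K + 2) * Real.exp (ρ / 2) := by nlinarith
    have h6 : rhoDist ρ f g * Real.exp (-ρ) ≤ (K + 2) * Real.exp (ρ / 2) * Real.exp (-ρ) :=
      mul_le_mul_of_nonneg_right h5 (Real.exp_pos _).le
    have h7 : Real.exp (ρ / 2) * Real.exp (-ρ) ≤ Real.exp (-(T / 4)) * Real.exp (-(1 / 4) * ρ) := by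
      rw [← Real.exp_add, ← Real.exp_add]
      exact Real.exp_le_exp.2 (by linarith)
    have h8 := mul_le_mul_of_nonneg_left h7 (by linarith : 0 ≤ K + 2)
    rw [mul_assoc] at h6
    rw [mul_assoc]
    linarith

/-- Pointwise convergence of the distance functions to the hypographs implies aw-convergence. -/
theorem tendsto_of_tendsto_infDist {l : Filter (UscFcns S c)} {g : UscFcns S c}
    (h : ∀ p, Tendsto (fun f : UscFcns S c => Metric.infDist p f.hypo) l
      (𝓝 (Metric.infDist p g.hypo))) : l ≤ 𝓝 g := by
  rw [Metric.nhds_basis_ball.ge_iff]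
  intro ε hε
  set K := Metric.infDist (centre c) g.hypo with hK
  have hK0 : 0 ≤ K := Metric.infDist_nonneg
  have hlim : Tendsto (fun T : ℝ => (K + 1 + K + 2) * (4 * Real.exp (-(T / 4)))) atTop (𝓝 0) := by
    have : Tendsto (fun T : ℝ => Real.exp (-(T / 4))) atTop (𝓝 0) :=
      Real.tendsto_exp_neg_atTop_nhds_zero.comp (tendsto_id.atTop_div_const (by norm_num))
    simpa using (this.const_mul 4).const_mul (K + 1 + K + 2)
  obtain ⟨T, hT⟩ := (hlim.eventually (gt_mem_nhds (half_pos hε))).exists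
  -- Passing to a net point and back costs `ε / 8` per distance function, and the net contributes a
  -- third `ε / 8`; the tail beyond `T` is below `ε / 2`.
  have hε8 : 0 < ε / 8 := by positivity
  obtain ⟨t, -, htf, ht⟩ := (isCompact_closedBall (centre c) T).finite_cover_balls hε8
  have h1 : ∀ᶠ f : UscFcns S c in l, ∀ p ∈ t,
      |Metric.infDist p f.hypo - Metric.infDist p g.hypo| < ε / 8 := by
    rw [eventually_all_finite htf]
    intro p _
    have := (h p).eventually (Metric.ball_mem_nhds _ hε8)
    filter_upwards [this] with f hf
    rwa [← Real.dist_eq]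
  have h2 : ∀ᶠ f : UscFcns S c in l, Metric.infDist (centre c) f.hypo < K + 1 :=
    (h (centre c)).eventually (gt_mem_nhds (by linarith))
  filter_upwards [h1, h2] with f hf hfK
  have h3 : rhoDist T f g ≤ 3 * (ε / 8) := by
    refine Real.iSup_le (fun p => ?_) (by positivity)
    obtain ⟨q, hq, hpq⟩ := mem_iUnion₂.1 (ht p.2)
    have hpq' : dist p.1 q < ε / 8 := hpq
    have a1 := Metric.infDist_le_infDist_add_dist (x := p.1) (y := q) (s := f.hypo)
    have a2 := Metric.infDist_le_infDist_add_dist (x := q) (y := p.1) (s := f.hypo)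
    have a3 := Metric.infDist_le_infDist_add_dist (x := p.1) (y := q) (s := g.hypo)
    have a4 := Metric.infDist_le_infDist_add_dist (x := q) (y := p.1) (s := g.hypo)
    have a5 := abs_lt.1 (hf q hq)
    rw [dist_comm q] at a2 a4
    rw [abs_le]
    constructor <;> linarith
  have h4 := dist_le_rhoDist_add T f g
  have h5 : (Metric.infDist (centre c) f.hypo + Metric.infDist (centre c) g.hypo + 2) *
      (4 * Real.exp (-(T / 4))) ≤ (K + 1 + K + 2) * (4 * Real.exp (-(T / 4))) :=
    mul_le_mul_of_nonneg_right (by linarith) (by positivity)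
  rw [Metric.mem_ball]
  linarith

/-- An ultrafilter of functions whose hypographs stay near the centre converges. -/
theorem exists_ultrafilter_le_nhds (hS : IsClosed S) (U : Ultrafilter (UscFcns S c)) {R : ℝ}
    (hU : ∀ᶠ f in (U : Filter (UscFcns S c)), Metric.infDist (centre c) f.hypo ≤ R) :
    ∃ g, (U : Filter (UscFcns S c)) ≤ 𝓝 g := by
  have hbd : ∀ p, ∀ᶠ f : UscFcns S c in (U : Filter (UscFcns S c)),
      Metric.infDist p f.hypo ≤ R + dist p (centre c) := by
    intro p
    filter_upwards [hU] with f hf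
    exact Metric.infDist_le_infDist_add_dist.trans (by linarith)
  have hlim : ∀ p, ∃ r, Tendsto (fun f : UscFcns S c => Metric.infDist p f.hypo) U (𝓝 r) := by
    intro p
    obtain ⟨r, -, hr⟩ := (isCompact_Icc (a := (0 : ℝ)) (b := R + dist p (centre c))).ultrafilter_le_nhds
      (U.map fun f => Metric.infDist p f.hypo) (by
        rw [le_principal_iff]
        exact (hbd p).mono fun f hf => ⟨Metric.infDist_nonneg, hf⟩)
    exact ⟨r, hr⟩
  choose u hu using hlim
  have hu0 : ∀ p, 0 ≤ u p := fun p => ge_of_tendsto' (hu p) fun f => Metric.infDist_nonneg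
  have hLip : ∀ p q, u p ≤ u q + dist p q := fun p q =>
    le_of_tendsto_of_tendsto' (hu p) ((hu q).add_const _)
      fun f => Metric.infDist_le_infDist_add_dist
  -- The nearest points of `p` in the hypographs stay bounded, so they converge along the
  -- ultrafilter. Their limit shows that `u` is the distance function of its own zero set.
  have hnear : ∀ p, ∃ q, u q = 0 ∧ dist p q = u p := by
    intro p
    choose n hn hd using fun f : UscFcns S c =>
      (isClosed_hypo hS f).exists_infDist_eq_dist f.hypo_nonempty p
    obtain ⟨q, -, hq⟩ := (isCompact_closedBall p (R + dist p (centre c))).ultrafilter_le_nhds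
      (U.map n) (by
        rw [le_principal_iff]
        refine (hbd p).mono fun f hf => ?_
        rw [Metric.mem_closedBall, dist_comm, ← hd f]
        exact hf)
    have hq' : Tendsto n U (𝓝 q) := hq
    refine ⟨q, le_antisymm ?_ (hu0 q), ?_⟩
    · have h1 : Tendsto (fun f => dist q (n f)) U (𝓝 (dist q q)) := tendsto_const_nhds.dist hq'
      rw [dist_self] at h1
      exact le_of_tendsto_of_tendsto' (hu q) h1 fun f => Metric.infDist_le_dist_of_mem (hn f)
    · refine tendsto_nhds_unique (tendsto_const_nhds.dist hq') ((hu p).congr fun f => hd f)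
  have hcont : Continuous u := by
    refine (LipschitzWith.of_le_add fun p q => hLip p q).continuous
  have hH : IsClosed {p | u p = 0} := isClosed_eq hcont continuous_const
  have hHS : ∀ p ∈ {p | u p = 0}, p.1 ∈ S := by
    intro p hp
    have hp0 : u p = 0 := hp
    rw [← hS.closure_eq, Metric.mem_closure_iff]
    intro ε hε
    obtain ⟨f, hf⟩ := ((hu p).eventually (gt_mem_nhds (hp0 ▸ hε))).exists
    obtain ⟨q, hq, hpq⟩ := (Metric.infDist_lt_iff f.hypo_nonempty).1 hf
    exact ⟨q.1, hq.1, lt_of_le_of_lt (le_max_left _ _) hpq⟩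
  have hdown : ∀ x a b, (x, a) ∈ {p | u p = 0} → b ≤ a → (x, b) ∈ {p | u p = 0} := by
    intro x a b hxa hba
    refine le_antisymm ?_ (hu0 _)
    rw [← show u (x, a) = 0 from hxa]
    refine le_of_tendsto_of_tendsto' (hu (x, b)) (hu (x, a)) fun f => ?_
    refine (Metric.le_infDist f.hypo_nonempty).2 fun q hq => ?_
    obtain ⟨hqS, hqf⟩ := hq
    -- Shifting `q` down by `a - b` preserves its distance when `(x, a)` is shifted to `(x, b)`.
    have h1 : (q.1, q.2 - (a - b)) ∈ f.hypo :=
      ⟨hqS, le_trans (EReal.coe_le_coe_iff.2 (by simp [hba])) hqf⟩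
    refine (Metric.infDist_le_dist_of_mem h1).trans_eq ?_
    simp only [Prod.dist_eq, Real.dist_eq]
    congr 2
    ring
  obtain ⟨g, hg⟩ := exists_hypo_eq (S := S) (c := c) hH
    ((hnear (centre c)).imp fun q hq => hq.1) hHS hdown
  refine ⟨g, tendsto_of_tendsto_infDist fun p => ?_⟩
  have : Metric.infDist p g.hypo = u p := by
    rw [hg]
    obtain ⟨q, hq, hpq⟩ := hnear p
    refine le_antisymm (hpq ▸ Metric.infDist_le_dist_of_mem hq) ?_
    refine (Metric.le_infDist ⟨q, hq⟩).2 fun q' hq' => ?_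
    have := hLip p q'
    rwa [show u q' = 0 from hq', zero_add] at this
  rw [this]
  exact hu p

theorem properSpace (hS : IsClosed S) : ProperSpace (UscFcns S c) := by
  refine ⟨fun f r => isCompact_iff_ultrafilter_le_nhds.2 fun U hU => ?_⟩
  have hmem : ∀ᶠ g in (U : Filter (UscFcns S c)), g ∈ Metric.closedBall f r := le_principal_iff.1 hU
  obtain ⟨g, hg⟩ := exists_ultrafilter_le_nhds hS U
    (R := Metric.infDist (centre c) f.hypo + r) (by
      filter_upwards [hmem] with g hg
      have h1 := (abs_le.1 (abs_infDist_centre_sub_le g f)).2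
      have h2 : dist g f ≤ r := hg
      linarith)
  exact ⟨g, Metric.isClosed_closedBall.mem_of_tendsto (tendsto_id'.2 hg) hmem, hg⟩

theorem isCompact_of_common_minorant (hS : IsClosed S) {F : Set (UscFcns S c)} (hF : IsClosed F)
    {x : S} {α : ℝ} (h : ∀ f ∈ F, (α : EReal) ≤ f x) : IsCompact F := by
  refine isCompact_iff_ultrafilter_le_nhds.2 fun U hU => ?_
  have hmem : ∀ᶠ g in (U : Filter (UscFcns S c)), g ∈ F := le_principal_iff.1 hU
  obtain ⟨g, hg⟩ := exists_ultrafilter_le_nhds hS U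
    (R := dist (centre c) ((x : EuclideanSpace ℝ (Fin d)), α)) (by
      filter_upwards [hmem] with g hg
      exact Metric.infDist_le_dist_of_mem ⟨x.2, h g hg⟩)
  exact ⟨g, hF.mem_of_tendsto (tendsto_id'.2 hg) hmem, hg⟩

end UscFcns

/-! ### The extended integral. -/

section ExtIntegral

variable {Ξ : Type*} [MeasurableSpace Ξ] {P : Measure Ξ}

theorem extIntegral_mono {h₁ h₂ : Ξ → EReal} (h : ∀ x, h₁ x ≤ h₂ x) :
    extIntegral P h₁ ≤ extIntegral P h₂ := by
  refine EReal.neg_le_neg_iff.2 (EReal.sub_le_sub ?_ ?_) <;>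
    refine EReal.coe_ennreal_le_coe_ennreal_iff.2 (lintegral_mono fun x => ?_)
  · exact EReal.toENNReal_le_toENNReal (EReal.neg_le_neg_iff.2 (h x))
  · exact EReal.toENNReal_le_toENNReal (h x)

theorem bot_lt_extIntegral {h : Ξ → EReal} (hneg : ∫⁻ x, (-h x).toENNReal ∂P < ⊤) :
    ⊥ < extIntegral P h := by
  rw [extIntegral, ← EReal.neg_top, EReal.neg_lt_neg_iff, sub_eq_add_neg, lt_top_iff_ne_top]
  refine EReal.add_ne_top ?_ ?_
  · simpa using hneg.ne
  · simp

theorem lintegral_toENNReal_lt_top {h : Ξ → EReal} (hlt : extIntegral P h < ⊤) : ∫⁻ x, (h x).toENNReal ∂P < ⊤ := by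
  by_contra hcon
  rw [not_lt, top_le_iff] at hcon
  rw [extIntegral, hcon] at hlt
  simp at hlt

/-- Monotone convergence for the extended integral. -/
theorem tendsto_extIntegral_of_monotone {h : Ξ → EReal} {g : ℕ → Ξ → EReal}
    (hg : ∀ k, Measurable (g k)) (hmono : ∀ x, Monotone fun k => g k x)
    (hlim : ∀ x, Tendsto (fun k => g k x) atTop (𝓝 (h x)))
    (hneg : ∫⁻ x, (-g 0 x).toENNReal ∂P < ⊤) :
    Tendsto (fun k => extIntegral P (g k)) atTop (𝓝 (extIntegral P h)) := by
  have h1 : Tendsto (fun k => ∫⁻ x, (g k x).toENNReal ∂P) atTop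
      (𝓝 (∫⁻ x, (h x).toENNReal ∂P)) :=
    lintegral_tendsto_of_tendsto_of_monotone (fun k => (hg k).ereal_toENNReal.aemeasurable)
      (Eventually.of_forall fun x a b hab => EReal.toENNReal_le_toENNReal (hmono x hab))
      (Eventually.of_forall fun x => (EReal.continuous_toENNReal.tendsto _).comp (hlim x))
  have h2 : Tendsto (fun k => ∫⁻ x, (-g k x).toENNReal ∂P) atTop
      (𝓝 (∫⁻ x, (-h x).toENNReal ∂P)) :=
    lintegral_tendsto_of_tendsto_of_antitone
      (fun k => (hg k).neg.ereal_toENNReal.aemeasurable)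
      (Eventually.of_forall fun x a b hab =>
        EReal.toENNReal_le_toENNReal (EReal.neg_le_neg_iff.2 (hmono x hab))) hneg.ne
      (Eventually.of_forall fun x =>
        (EReal.continuous_toENNReal.tendsto _).comp ((continuous_neg.tendsto _).comp (hlim x)))
  have h3 : ∫⁻ x, (-h x).toENNReal ∂P ≠ ⊤ := by
    refine ((lintegral_mono fun x => EReal.toENNReal_le_toENNReal
      (EReal.neg_le_neg_iff.2 ?_)).trans_lt hneg).ne
    exact (hmono x).ge_of_tendsto (hlim x) 0
  refine (continuous_neg.tendsto _).comp ?_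
  -- Addition is continuous here because the limit of the negative parts is finite.
  refine Tendsto.comp (EReal.continuousAt_add (p := (_, -_)) (Or.inl ?_) (Or.inl ?_))
    (((continuous_coe_ennreal_ereal.tendsto _).comp h2).prodMk_nhds
      ((continuous_neg.tendsto _).comp ((continuous_coe_ennreal_ereal.tendsto _).comp h1)))
  · simpa using h3
  · simp

theorem ae_ne_bot_of_lintegral_neg {h : Ξ → EReal} (hm : Measurable h)
    (hneg : ∫⁻ x, (-h x).toENNReal ∂P < ⊤) : ∀ᵐ x ∂P, h x ≠ ⊥ := by
  filter_upwards [ae_lt_top hm.neg.ereal_toENNReal hneg.ne] with x hx hb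
  simp [hb] at hx

theorem ae_ne_top_of_lintegral_pos {h : Ξ → EReal} (hm : Measurable h)
    (hpos : ∫⁻ x, (h x).toENNReal ∂P < ⊤) : ∀ᵐ x ∂P, h x ≠ ⊤ := by
  filter_upwards [ae_lt_top hm.ereal_toENNReal hpos.ne] with x hx hb
  simp [hb] at hx

theorem integrable_toReal_of_lintegral {h : Ξ → EReal} (hm : Measurable h)
    (hneg : ∫⁻ x, (-h x).toENNReal ∂P < ⊤) (hpos : ∫⁻ x, (h x).toENNReal ∂P < ⊤) :
    Integrable (fun x => (h x).toReal) P := by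
  refine ⟨hm.ereal_toReal.aestronglyMeasurable, ?_⟩
  refine lt_of_le_of_lt (lintegral_mono fun x => ?_)
    ((lintegral_add_left hm.ereal_toENNReal _).trans_lt (ENNReal.add_lt_top.2 ⟨hpos, hneg⟩))
  simp only
  induction h x using EReal.rec with
  | bot => simp
  | top => simp
  | coe r =>
    rw [← EReal.coe_neg, EReal.real_coe_toENNReal, EReal.real_coe_toENNReal, EReal.toReal_coe,
      Real.enorm_eq_ofReal_abs]
    rcases le_total 0 r with hr | hr
    · rw [abs_of_nonneg hr]
      exact le_self_add
    · rw [abs_of_nonpos hr]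
      exact le_add_self

theorem extIntegral_eq_integral {h : Ξ → EReal} (hm : Measurable h)
    (hneg : ∫⁻ x, (-h x).toENNReal ∂P < ⊤) (hpos : ∫⁻ x, (h x).toENNReal ∂P < ⊤) :
    extIntegral P h = ((∫ x, (h x).toReal ∂P : ℝ) : EReal) := by
  have hfin := (ae_ne_top_of_lintegral_pos hm hpos).and (ae_ne_bot_of_lintegral_neg hm hneg)
  have h1 : ∫⁻ x, ENNReal.ofReal (h x).toReal ∂P = ∫⁻ x, (h x).toENNReal ∂P := by
    refine lintegral_congr_ae (hfin.mono fun x hx => ?_)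
    exact (EReal.toENNReal_of_ne_top hx.1).symm
  have h2 : ∫⁻ x, ENNReal.ofReal (-(h x).toReal) ∂P = ∫⁻ x, (-h x).toENNReal ∂P := by
    refine lintegral_congr_ae (hfin.mono fun x hx => ?_)
    have : -h x ≠ ⊤ := by simpa using hx.2
    simp only
    rw [EReal.toENNReal_of_ne_top this, EReal.toReal_neg_eq]
  rw [integral_eq_lintegral_pos_part_sub_lintegral_neg_part
    (integrable_toReal_of_lintegral hm hneg hpos), h1, h2, extIntegral]
  lift ∫⁻ x, (h x).toENNReal ∂P to ℝ≥0 using hpos.ne with a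
  lift ∫⁻ x, (-h x).toENNReal ∂P to ℝ≥0 using hneg.ne with b
  simp only [ENNReal.coe_toReal]
  rw [EReal.neg_sub (Or.inl (by simp)) (Or.inl (by simp)), add_comm, ← sub_eq_add_neg]
  rfl

end ExtIntegral

theorem extSum_mono {ι : Type*} {s : Finset ι} {a b : ι → EReal} (h : ∀ j, a j ≤ b j) :
    extSum s a ≤ extSum s b :=
  EReal.neg_le_neg_iff.2 (Finset.sum_le_sum fun j _ => EReal.neg_le_neg_iff.2 (h j))

theorem extSum_coe {ι : Type*} (s : Finset ι) (a : ι → ℝ) :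
    extSum s (fun j => (a j : EReal)) = ((∑ j ∈ s, a j : ℝ) : EReal) := by
  classical
  have : ∑ j ∈ s, -(a j : EReal) = ((∑ j ∈ s, -a j : ℝ) : EReal) := by
    induction s using Finset.induction_on with
    | empty => simp
    | insert i s hi ih => rw [Finset.sum_insert hi, Finset.sum_insert hi, ih]; norm_cast
  rw [extSum, this, ← EReal.coe_neg, Finset.sum_neg_distrib, neg_neg]

/-! ### The strong law for the sample. -/

section Sample

variable {Ω Ξ : Type*} [MeasurableSpace Ω] [MeasurableSpace Ξ] {μ : Measure Ω} {P : Measure Ξ}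
  {X : ℕ → Ω → Ξ}

/-- A complete sigma-algebra on `Ξ` need not be countably generated, so a.e. measurability is
obtained only after composing into a countably generated space. -/
theorem IsIIDSample.aemeasurable_comp (hX : IsIIDSample μ P X) {γ : Type*} [MeasurableSpace γ]
    [MeasurableSpace.CountablyGenerated γ] {h : Ξ → γ} (hh : Measurable h) (j : ℕ) :
    AEMeasurable (fun ω => h (X j ω)) μ :=
  (hh.comp_nullMeasurable (hX.1 j)).aemeasurable

theorem IsIIDSample.map_comp (hX : IsIIDSample μ P X) {γ : Type*} [MeasurableSpace γ]
    [MeasurableSpace.CountablyGenerated γ] {h : Ξ → γ} (hh : Measurable h) (j : ℕ) :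
    μ.map (fun ω => h (X j ω)) = P.map h := by
  ext A hA
  rw [Measure.map_apply_of_aemeasurable (hX.aemeasurable_comp hh j) hA, Measure.map_apply hh hA]
  exact hX.2.1 j _ (hh hA)

theorem IsIIDSample.lintegral_comp (hX : IsIIDSample μ P X) {u : Ξ → ℝ≥0∞} (hu : Measurable u)
    (j : ℕ) : ∫⁻ ω, u (X j ω) ∂μ = ∫⁻ x, u x ∂P := by
  have h1 := lintegral_map' (μ := μ) (f := id) aemeasurable_id (hX.aemeasurable_comp hu j)
  have h2 := lintegral_map (μ := P) measurable_id hu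
  rw [hX.map_comp hu j] at h1
  exact h1.symm.trans h2

theorem IsIIDSample.extIntegral_comp (hX : IsIIDSample μ P X) {h : Ξ → EReal} (hh : Measurable h)
    (j : ℕ) : extIntegral μ (fun ω => h (X j ω)) = extIntegral P h := by
  rw [extIntegral, extIntegral, hX.lintegral_comp hh.ereal_toENNReal j,
    hX.lintegral_comp (u := fun x => (-h x).toENNReal) hh.neg.ereal_toENNReal j]

theorem IsIIDSample.ae_comp (hX : IsIIDSample μ P X) {p : Ξ → Prop}
    (hp : MeasurableSet {x | p x}) (h : ∀ᵐ x ∂P, p x) (j : ℕ) : ∀ᵐ ω ∂μ, p (X j ω) :=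
  (hX.2.1 j _ hp.compl).trans h

/-- The strong law of large numbers for extended real-valued functions of the sample. -/
theorem IsIIDSample.ae_tendsto_extSum [IsProbabilityMeasure μ] (hX : IsIIDSample μ P X)
    {h : Ξ → EReal} (hm : Measurable h)
    (hneg : ∫⁻ x, (-h x).toENNReal ∂P < ⊤) (hpos : ∫⁻ x, (h x).toENNReal ∂P < ⊤) :
    ∀ᵐ ω ∂μ, Tendsto (fun n : ℕ => (((n : ℝ)⁻¹ : ℝ) : EReal) *
      extSum (Finset.range n) (fun j => h (X j ω))) atTop (𝓝 (extIntegral P h)) := by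
  have hr : Measurable fun x => (h x).toReal := hm.ereal_toReal
  have hint := integrable_toReal_of_lintegral hm hneg hpos
  have hid : ∀ i, IdentDistrib (fun ω => (h (X i ω)).toReal) (fun ω => (h (X 0 ω)).toReal) μ μ :=
    fun i => ⟨hX.aemeasurable_comp hr i, hX.aemeasurable_comp hr 0,
      (hX.map_comp hr i).trans (hX.map_comp hr 0).symm⟩
  have hid' : IdentDistrib (fun ω => (h (X 0 ω)).toReal) (fun x => (h x).toReal) μ P :=
    ⟨hX.aemeasurable_comp hr 0, hr.aemeasurable, hX.map_comp hr 0⟩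
  have hlln := strong_law_ae_real (fun j ω => (h (X j ω)).toReal) (hid'.integrable_iff.2 hint)
    (fun i j hij => (hX.2.2.indepFun hij).comp hr hr) hid
  rw [hid'.integral_eq] at hlln
  -- Almost surely no infinite value is sampled, so the extended sums are real sums.
  have hfin : ∀ᵐ ω ∂μ, ∀ j, h (X j ω) ≠ ⊤ ∧ h (X j ω) ≠ ⊥ :=
    ae_all_iff.2 fun j => hX.ae_comp (p := fun x => h x ≠ ⊤ ∧ h x ≠ ⊥)
      ((hm (measurableSet_singleton _)).compl.inter (hm (measurableSet_singleton _)).compl)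
      ((ae_ne_top_of_lintegral_pos hm hpos).and (ae_ne_bot_of_lintegral_neg hm hneg)) j
  rw [extIntegral_eq_integral hm hneg hpos]
  filter_upwards [hlln, hfin] with ω h1 h2
  refine (EReal.tendsto_coe.2 h1).congr fun n => ?_
  have h3 : (fun j => h (X j ω)) = fun j => (((h (X j ω)).toReal : ℝ) : EReal) :=
    funext fun j => (EReal.coe_toReal (h2 j).1 (h2 j).2).symm
  rw [h3, extSum_coe, ← EReal.coe_mul, div_eq_inv_mul]

end Sample

/-! ### Pointwise limits and the lower half of epi-convergence. -/

section Epi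

theorem toENNReal_neg_min_le {i j : EReal} (h : j ≤ i) (m : ℕ) :
    (-(min i (m : EReal))).toENNReal ≤ (-j).toENNReal := by
  rcases le_total i m with hi | hi
  · rw [min_eq_left hi]
    exact EReal.toENNReal_le_toENNReal (EReal.neg_le_neg_iff.2 h)
  · rw [min_eq_right hi, EReal.toENNReal_of_nonpos]
    · exact zero_le
    · rw [EReal.neg_le, neg_zero]
      exact Nat.cast_nonneg' m

variable {Ξ Y : Type*} [MeasurableSpace Ξ] [MetricSpace Y] {ψ : Ξ → Y → EReal}

theorem LocallyInfIntegrable.lintegral_neg_lt_top {P : Measure Ξ}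
    (hψ' : LocallyInfIntegrable P ψ) (f : Y) : ∫⁻ x, (-ψ x f).toENNReal ∂P < ⊤ := by
  obtain ⟨ρ, hρ, h⟩ := hψ' f
  refine (lintegral_mono fun x => EReal.toENNReal_le_toENNReal
    (EReal.neg_le_neg_iff.2 ?_)).trans_lt h
  exact iInf₂_le f (by simpa using hρ.le)

variable [MeasurableSpace Y]

theorem IsRandomLsc.measurable_section (hψ : IsRandomLsc ψ) (f : Y) :
    Measurable fun x => ψ x f :=
  hψ.2.comp measurable_prodMk_right

/-- Almost surely, the penalized empirical risks converge at a point of finite risk. -/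
theorem ae_tendsto_penalizedRisk {P : Measure Ξ} {Ω : Type*} [MeasurableSpace Ω] {μ : Measure Ω}
    [IsProbabilityMeasure μ] {X : ℕ → Ω → Ξ} (hψ : IsRandomLsc ψ)
    (hψ' : LocallyInfIntegrable P ψ) (hX : IsIIDSample μ P X) {pen : ℕ → Y → ℝ≥0} {f : Y}
    (hpen : Tendsto (fun n => pen n f) atTop (𝓝 0))
    (hf : extIntegral P (fun x => ψ x f) < ⊤) :
    ∀ᵐ ω ∂μ, Tendsto (fun n => penalizedRisk ψ pen (fun j => X j ω) n f) atTop
      (𝓝 (extIntegral P fun x => ψ x f)) := by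
  filter_upwards [hX.ae_tendsto_extSum (hψ.measurable_section f) (hψ'.lintegral_neg_lt_top f)
    (lintegral_toENNReal_lt_top hf)] with ω hω
  have h1 : Tendsto (fun n => ((pen n f : ℝ) : EReal)) atTop (𝓝 ((0 : ℝ) : EReal)) :=
    EReal.tendsto_coe.2 (NNReal.tendsto_coe.2 hpen)
  have h2 := (EReal.continuousAt_add (p := (extIntegral P fun x => ψ x f, ((0 : ℝ) : EReal)))
    (Or.inr (by simp)) (Or.inr (by simp))).tendsto.comp (hω.prodMk_nhds h1)
  simpa [Function.comp_def, penalizedRisk] using h2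

variable [BorelSpace Y] [PolishSpace Y]

theorem IsRandomLsc.measurable_min_biInf (hψ : IsRandomLsc ψ) (P : Measure Ξ)
    [IsFiniteMeasure P] [P.IsComplete] {U : Set Y} (hU : IsOpen U) (m : ℕ) :
    Measurable fun x => min (⨅ g ∈ U, ψ x g) (m : EReal) :=
  (measurable_biInf_of_measurable_uncurry P hψ.2 hU.measurableSet).min measurable_const

variable {P : Measure Ξ} [IsProbabilityMeasure P] [P.IsComplete]

/-- The expectation of a random lsc function is approximated from below by the expectations of
its truncated infima over basic neighbourhoods. -/
theorem IsRandomLsc.exists_mem_countableBasis (hψ : IsRandomLsc ψ)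
    (hψ' : LocallyInfIntegrable P ψ) (f : Y) {α : EReal}
    (hα : α < extIntegral P fun x => ψ x f) :
    ∃ U ∈ TopologicalSpace.countableBasis Y, f ∈ U ∧ ∃ m : ℕ,
      ∫⁻ x, (-(min (⨅ g ∈ U, ψ x g) (m : EReal))).toENNReal ∂P < ⊤ ∧
      α < extIntegral P fun x => min (⨅ g ∈ U, ψ x g) (m : EReal) := by
  obtain ⟨ρ, hρ, hint⟩ := hψ' f
  set r : ℕ → ℝ := fun k => ρ / ((k : ℝ) + 1) with hr
  have hrpos : ∀ k, 0 < r k := fun k => by positivity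
  have hranti : Antitone r := fun a b hab => by
    have : (a : ℝ) ≤ b := Nat.cast_le.2 hab
    exact div_le_div_of_nonneg_left hρ.le (by positivity) (by linarith)
  have hrlim : Tendsto r atTop (𝓝 0) := by
    have := tendsto_one_div_add_atTop_nhds_zero_nat (𝕜 := ℝ) |>.const_mul ρ
    simpa [hr, div_eq_mul_inv] using this
  have hle : ∀ (V : Set Y) (_ : V ⊆ Metric.ball f (r 0)) (x : Ξ),
      (⨅ (g : Y) (_ : dist f g ≤ ρ), ψ x g) ≤ ⨅ g ∈ V, ψ x g := by
    intro V hV x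
    refine le_iInf₂ fun g hg => iInf₂_le g ?_
    have h1 := Metric.mem_ball'.1 (hV hg)
    have h2 : r 0 = ρ := by simp [hr]
    exact (h2 ▸ h1).le
  have hnegV : ∀ (V : Set Y) (_ : V ⊆ Metric.ball f (r 0)) (m : ℕ),
      ∫⁻ x, (-(min (⨅ g ∈ V, ψ x g) (m : EReal))).toENNReal ∂P < ⊤ := fun V hV m =>
    (lintegral_mono fun x => toENNReal_neg_min_le (hle V hV x) m).trans_lt hint
  -- Radius and truncation level share the index `k`. Truncation keeps the positive part integrable,
  -- as the strong law requires later.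
  have hlim := tendsto_extIntegral_of_monotone (P := P) (h := fun x => ψ x f)
    (g := fun k x => min (⨅ g ∈ Metric.ball f (r k), ψ x g) (k : EReal))
    (fun k => hψ.measurable_min_biInf P Metric.isOpen_ball k)
    (fun x a b hab => min_le_min
      (biInf_mono fun g hg => Metric.ball_subset_ball (hranti hab) hg) (by exact_mod_cast hab))
    (fun x => by
      rw [tendsto_order]
      constructor
      · intro a ha
        obtain ⟨b, hab, hb⟩ := exists_between ha
        obtain ⟨δ, hδ, hball⟩ := Metric.eventually_nhds_iff_ball.1 (hψ.1 x f b hb)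
        have h1 : ∀ᶠ k : ℕ in atTop, a < (k : EReal) := by
          obtain ⟨q, hq, -⟩ := EReal.lt_iff_exists_real_btwn.1 (ha.trans_le le_top)
          obtain ⟨N, hN⟩ := exists_nat_gt q
          filter_upwards [eventually_ge_atTop N] with k hk
          refine hq.trans ?_
          have : q < (k : ℝ) := hN.trans_le (Nat.cast_le.2 hk)
          exact_mod_cast this
        filter_upwards [h1, hrlim.eventually (gt_mem_nhds hδ)] with k hk hkδ
        refine lt_min (hab.trans_le ?_) hk
        exact le_iInf₂ fun g hg => (hball g (Metric.ball_subset_ball hkδ.le hg)).le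
      · intro a ha
        refine Eventually.of_forall fun k => lt_of_le_of_lt ?_ ha
        exact (min_le_left _ _).trans (iInf₂_le f (Metric.mem_ball_self (hrpos k))))
    (hnegV _ subset_rfl 0)
  obtain ⟨k, hk⟩ := (hlim.eventually (lt_mem_nhds hα)).exists
  obtain ⟨U, hU, hfU, hUsub⟩ := (TopologicalSpace.isBasis_countableBasis Y).mem_nhds_iff.1
    (Metric.ball_mem_nhds f (hrpos k))
  refine ⟨U, hU, hfU, k, hnegV U (hUsub.trans (Metric.ball_subset_ball (hranti k.zero_le))) k,
    hk.trans_le (extIntegral_mono fun x => min_le_min_right _ ?_)⟩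
  exact biInf_mono fun g hg => hUsub hg

variable {Ω : Type*} [MeasurableSpace Ω] {μ : Measure Ω} [IsProbabilityMeasure μ] {X : ℕ → Ω → Ξ}

/-- Almost surely, the penalized empirical risks satisfy the lower half of epi-convergence. -/
theorem ae_forall_exists_nhds_lt_penalizedRisk (hψ : IsRandomLsc ψ)
    (hψ' : LocallyInfIntegrable P ψ) (hX : IsIIDSample μ P X) (pen : ℕ → Y → ℝ≥0) :
    ∀ᵐ ω ∂μ, ∀ (f : Y) (α : EReal), α < extIntegral P (fun x => ψ x f) →
      ∃ U ∈ 𝓝 f, ∀ᶠ n in atTop, ∀ g ∈ U, α < penalizedRisk ψ pen (fun j => X j ω) n g := by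
  -- Countably many pairs `U`, `m` give one null set serving every `f` and `α`.
  have hbasis : ∀ᵐ ω ∂μ, ∀ U ∈ TopologicalSpace.countableBasis Y, ∀ m : ℕ,
      ∫⁻ x, (-(min (⨅ g ∈ U, ψ x g) (m : EReal))).toENNReal ∂P < ⊤ →
      Tendsto (fun n : ℕ => (((n : ℝ)⁻¹ : ℝ) : EReal) *
        extSum (Finset.range n) (fun j => min (⨅ g ∈ U, ψ (X j ω) g) (m : EReal))) atTop
        (𝓝 (extIntegral P fun x => min (⨅ g ∈ U, ψ x g) (m : EReal))) := by
    refine (ae_ball_iff (TopologicalSpace.countable_countableBasis Y)).2 fun U hU => ?_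
    refine ae_all_iff.2 fun m => eventually_imp_distrib_left.2 fun hneg => ?_
    refine hX.ae_tendsto_extSum (h := fun x => min (⨅ g ∈ U, ψ x g) (m : EReal))
      (hψ.measurable_min_biInf P (TopologicalSpace.isOpen_of_mem_countableBasis hU) m) hneg ?_
    calc ∫⁻ x, (min (⨅ g ∈ U, ψ x g) (m : EReal)).toENNReal ∂P
        ≤ ∫⁻ _, ((m : EReal)).toENNReal ∂P :=
          lintegral_mono fun x => EReal.toENNReal_le_toENNReal (min_le_right _ _)
      _ < ⊤ := by
          rw [lintegral_const, measure_univ, mul_one, lt_top_iff_ne_top, EReal.toENNReal_ne_top_iff]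
          exact EReal.natCast_ne_top m
  filter_upwards [hbasis] with ω hω f α hα
  obtain ⟨U, hU, hfU, m, hneg, hlt⟩ := hψ.exists_mem_countableBasis hψ' f hα
  refine ⟨U, (TopologicalSpace.isOpen_of_mem_countableBasis hU).mem_nhds hfU, ?_⟩
  filter_upwards [(hω U hU m hneg).eventually (lt_mem_nhds hlt)] with n hn g hg
  refine hn.trans_le ?_
  refine le_trans (mul_le_mul_of_nonneg_left (extSum_mono fun j => ?_) ?_)
    (le_add_of_nonneg_right ?_)
  · exact (min_le_left _ _).trans (iInf₂_le g hg)
  · exact EReal.coe_nonneg.2 (by positivity)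
  · exact EReal.coe_nonneg.2 (pen n g).2

end Epi

/-! ### From epi-limits to minimizers. -/

section Argmin

variable {Y : Type*}

/-- A countable set on which a function approaches its infimum and that is dense in the set of
minimizers. -/
theorem exists_countable_minimizing [PseudoMetricSpace Y] [SecondCountableTopology Y]
    (φ : Y → EReal) : ∃ D : Set Y, D.Countable ∧ (∀ f g, φ g < φ f → ∃ g' ∈ D, φ g' < φ f) ∧
      argmin φ ⊆ closure (D ∩ argmin φ) := by
  obtain ⟨t, hts, htc, ht⟩ :=
    (TopologicalSpace.IsSeparable.of_separableSpace (argmin φ)).exists_countable_dense_subset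
  cases isEmpty_or_nonempty Y
  · exact ⟨∅, countable_empty, fun f => isEmptyElim f, fun f => isEmptyElim f⟩
  -- One point below each rational level suffices to approach the infimum.
  choose! u hu using fun (q : ℚ) (h : ∃ g, φ g < (((q : ℝ)) : EReal)) => h
  refine ⟨range u ∪ t, (countable_range u).union htc, fun f g hfg => ?_, ?_⟩
  · obtain ⟨q, hq1, hq2⟩ := EReal.lt_iff_exists_rat_btwn.1 hfg
    exact ⟨u q, Or.inl (mem_range_self q), (hu q ⟨g, hq1⟩).trans hq2⟩
  · exact ht.trans (closure_mono fun y hy => ⟨Or.inr hy, hts hy⟩)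

variable {φ : Y → EReal} {Φ : ℕ → Y → EReal} {D : Set Y}

/-- If `f` were not minimal, some `g' ∈ D` would do better by a fixed margin: near `f` the risks
exceed `β`, at `g'` they drop below `γ < β`, which near-minimality forbids once the tolerance is
below `β - γ`. -/
theorem outLim_epsArgmin_subset [TopologicalSpace Y]
    (hlow : ∀ (f : Y) (α : EReal), α < φ f → ∃ U ∈ 𝓝 f, ∀ᶠ n in atTop, ∀ g ∈ U, α < Φ n g)
    (hD : ∀ f g, φ g < φ f → ∃ g' ∈ D, φ g' < φ f)
    (hup : ∀ g ∈ D, φ g < ⊤ → Tendsto (fun n => Φ n g) atTop (𝓝 (φ g)))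
    {ε : ℕ → ℝ} (hε : Tendsto ε atTop (𝓝 0)) :
    OutLim (fun n => epsArgmin (ε n) (Φ n)) ⊆ argmin φ := by
  rintro f ⟨k, a, hk, ha, hlim⟩
  change φ f ≤ ⨅ g, φ g
  refine le_iInf fun g => ?_
  by_contra hg
  rw [not_le] at hg
  obtain ⟨g', hg'D, hg'⟩ := hD f g hg
  obtain ⟨β, hβ1, hβ2⟩ := EReal.lt_iff_exists_real_btwn.1 hg'
  obtain ⟨γ, hγ1, hγ2⟩ := EReal.lt_iff_exists_real_btwn.1 hβ1
  have hγβ : 0 < β - γ := sub_pos.2 (EReal.coe_lt_coe_iff.1 hγ2)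
  obtain ⟨U, hU, hev⟩ := hlow f β hβ2
  obtain ⟨i, h1, h2, h3, h4⟩ := ((hk.tendsto_atTop.eventually hev).and
    ((hlim.eventually hU).and (((hup g' hg'D (hg'.trans_le le_top)).comp
      hk.tendsto_atTop).eventually (gt_mem_nhds hγ1) |>.and
        ((hε.comp hk.tendsto_atTop).eventually (gt_mem_nhds hγβ))))).exists
  have h5 : (β : EReal) < γ + ε (k i) :=
    (h1 _ h2).trans_le ((ha i).trans (add_le_add_left ((iInf_le _ g').trans (le_of_lt h3)) _))
  rw [← EReal.coe_add, EReal.coe_lt_coe_iff] at h5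
  simp only [Function.comp_apply] at h4
  linarith

theorem innLim_subset_outLim [TopologicalSpace Y] (A : ℕ → Set Y) : InnLim A ⊆ OutLim A := by
  rintro f ⟨a, ha, hlim⟩
  obtain ⟨N, hN⟩ := eventually_atTop.1 ha
  exact ⟨fun i => i + N, fun i => a (i + N), fun i j hij => Nat.add_lt_add_right hij N,
    fun i => hN _ (Nat.le_add_left _ _), hlim.comp (tendsto_add_atTop_nat N)⟩

/-- Almost nearest points of `A n` to `f` work, since every `g ∈ E` near `f` eventually lies in `A
n`. -/
theorem mem_innLim_of_mem_closure [PseudoMetricSpace Y] {A : ℕ → Set Y} {E : Set Y}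
    (hE : ∀ g ∈ E, ∀ᶠ n in atTop, g ∈ A n) {f : Y} (hf : f ∈ closure E) : f ∈ InnLim A := by
  obtain ⟨g₀, hg₀⟩ := closure_nonempty_iff.1 ⟨f, hf⟩
  have h1 : ∀ n, ∃ a, (A n).Nonempty →
      a ∈ A n ∧ dist f a < Metric.infDist f (A n) + 1 / ((n : ℝ) + 1) := by
    intro n
    by_cases hn : (A n).Nonempty
    · obtain ⟨a, ha, hd⟩ := (Metric.infDist_lt_iff hn).1
        (lt_add_of_pos_right (Metric.infDist f (A n)) (Nat.one_div_pos_of_nat (n := n)))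
      exact ⟨a, fun _ => ⟨ha, hd⟩⟩
    · exact ⟨f, fun h => absurd h hn⟩
  choose a ha using h1
  refine ⟨a, (hE g₀ hg₀).mono fun n hn => (ha n ⟨g₀, hn⟩).1, ?_⟩
  rw [Metric.tendsto_nhds]
  intro e he
  obtain ⟨g, hg, hfg⟩ := Metric.mem_closure_iff.1 hf (e / 2) (half_pos he)
  filter_upwards [hE g hg, tendsto_one_div_add_atTop_nhds_zero_nat.eventually
    (gt_mem_nhds (half_pos he))] with n hn hn'
  have h2 := (ha n ⟨g, hn⟩).2
  have h3 := Metric.infDist_le_dist_of_mem (x := f) hn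
  rw [dist_comm]
  linarith

/-- Countably many null sequences are eventually dominated by a single one. -/
theorem exists_tendsto_zero_eventually_ge {δ : ℕ → ℕ → ℝ}
    (hδ : ∀ k, Tendsto (δ k) atTop (𝓝 0)) :
    ∃ ε : ℕ → ℝ, (∀ n, 0 ≤ ε n) ∧ Tendsto ε atTop (𝓝 0) ∧
      ∀ k, ∀ᶠ n in atTop, δ k n ≤ ε n := by
  -- Capping the `k`-th sequence at `b k` makes the supremum null: finitely many sequences matter at
  -- each scale, and each cap eventually becomes inactive.
  set b : ℕ → ℝ := fun k => 1 / ((k : ℝ) + 1) with hb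
  have hb0 : ∀ k, 0 < b k := fun k => Nat.one_div_pos_of_nat
  have hbanti : Antitone b := fun i j hij => Nat.one_div_le_one_div hij
  have hbdd : ∀ n, BddAbove (range fun k => min |δ k n| (b k)) := fun n =>
    ⟨b 0, forall_mem_range.2 fun k => (min_le_right _ _).trans (hbanti k.zero_le)⟩
  have h0 : ∀ n, 0 ≤ ⨆ k, min |δ k n| (b k) := fun n =>
    Real.iSup_nonneg fun k => le_min (abs_nonneg _) (hb0 k).le
  refine ⟨fun n => ⨆ k, min |δ k n| (b k), h0, ?_, fun k => ?_⟩
  · rw [Metric.tendsto_nhds]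
    intro e he
    obtain ⟨K, hK⟩ := exists_nat_one_div_lt (half_pos he)
    have h1 : ∀ᶠ n in atTop, ∀ k ∈ Iio K, |δ k n| < e / 2 := by
      rw [eventually_all_finite (finite_Iio K)]
      intro k _
      filter_upwards [(hδ k).eventually (Metric.ball_mem_nhds _ (half_pos he))] with n hn
      simpa using hn
    filter_upwards [h1] with n hn
    rw [Real.dist_eq, sub_zero, abs_of_nonneg (h0 n)]
    refine lt_of_le_of_lt (ciSup_le fun k => ?_) (half_lt_self he)
    rcases lt_or_ge k K with hk | hk
    · exact (min_le_left _ _).trans (hn k hk).le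
    · exact (min_le_right _ _).trans ((hbanti hk).trans hK.le)
  · filter_upwards [(hδ k).eventually (Metric.ball_mem_nhds _ (hb0 k))] with n hn
    have h1 : |δ k n| < b k := by simpa using hn
    refine (le_abs_self _).trans ?_
    conv_lhs => rw [← min_eq_left h1.le]
    exact le_ciSup (hbdd n) k

/-- A finite subcover makes the local lower bounds uniform; the risk at `g` bounds the infima from
above. -/
theorem tendsto_iInf_of_compactSpace [TopologicalSpace Y] [CompactSpace Y]
    (hlow : ∀ (f : Y) (α : EReal), α < φ f → ∃ U ∈ 𝓝 f, ∀ᶠ n in atTop, ∀ g ∈ U, α < Φ n g)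
    {g : Y} (hg : g ∈ argmin φ) (hup : Tendsto (fun n => Φ n g) atTop (𝓝 (φ g))) :
    Tendsto (fun n => ⨅ f, Φ n f) atTop (𝓝 (φ g)) := by
  rw [tendsto_order]
  constructor
  · intro a ha
    obtain ⟨b, hab, hb⟩ := exists_between ha
    choose U hU hev using fun f => hlow f b (hb.trans_le (hg.trans (iInf_le _ f)))
    obtain ⟨t, -, ht⟩ := isCompact_univ.elim_nhds_subcover U fun f _ => hU f
    filter_upwards [(Filter.eventually_all_finset t).2 fun f _ => hev f] with n hn
    refine hab.trans_le (le_iInf fun f => ?_)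
    obtain ⟨f', hf', hmem⟩ := mem_iUnion₂.1 (ht (mem_univ f))
    exact (hn f' hf' f hmem).le
  · intro a ha
    filter_upwards [hup.eventually (gt_mem_nhds ha)] with n hn
    exact (iInf_le _ g).trans_lt hn

theorem exists_setConverges_epsArgmin [PseudoMetricSpace Y] [CompactSpace Y]
    (hlow : ∀ (f : Y) (α : EReal), α < φ f → ∃ U ∈ 𝓝 f, ∀ᶠ n in atTop, ∀ g ∈ U, α < Φ n g)
    (hDc : D.Countable) (hD : ∀ f g, φ g < φ f → ∃ g' ∈ D, φ g' < φ f)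
    (hDd : argmin φ ⊆ closure (D ∩ argmin φ))
    (hup : ∀ g ∈ D, φ g < ⊤ → Tendsto (fun n => Φ n g) atTop (𝓝 (φ g)))
    (hbot : ∀ f, ⊥ < φ f) (hfin : ∃ f, φ f < ⊤) :
    ∃ ε : ℕ → ℝ, (∀ n, 0 ≤ ε n) ∧ Tendsto ε atTop (𝓝 0) ∧
      SetConverges (fun n => epsArgmin (ε n) (Φ n)) (argmin φ) := by
  suffices h : ∃ ε : ℕ → ℝ, (∀ n, 0 ≤ ε n) ∧ Tendsto ε atTop (𝓝 0) ∧
      ∀ g ∈ D ∩ argmin φ, ∀ᶠ n in atTop, g ∈ epsArgmin (ε n) (Φ n) by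
    obtain ⟨ε, h0, hε, hmem⟩ := h
    have h1 := outLim_epsArgmin_subset hlow hD hup hε
    have h2 : argmin φ ⊆ InnLim fun n => epsArgmin (ε n) (Φ n) := fun f hf =>
      mem_innLim_of_mem_closure hmem (hDd hf)
    have h3 := innLim_subset_outLim fun n => epsArgmin (ε n) (Φ n)
    exact ⟨ε, h0, hε, h1.antisymm (h2.trans h3), (h3.trans h1).antisymm h2⟩
  -- If the intersection is empty, so is `argmin φ` by density, and zero tolerances do.
  rcases (D ∩ argmin φ).eq_empty_or_nonempty with hemp | hne
  · exact ⟨fun _ => 0, fun _ => le_rfl, tendsto_const_nhds, by simp [hemp]⟩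
  obtain ⟨g, hg⟩ := (hDc.mono inter_subset_left).exists_eq_range hne
  have hgmem : ∀ k, g k ∈ D ∩ argmin φ := fun k => hg ▸ mem_range_self k
  obtain ⟨f₀, hf₀⟩ := hfin
  have hlt : ∀ k, φ (g k) < ⊤ := fun k => ((hgmem k).2.trans (iInf_le _ f₀)).trans_lt hf₀
  have hΦ : ∀ k, Tendsto (fun n => Φ n (g k)) atTop (𝓝 (φ (g k))) := fun k =>
    hup _ (hgmem k).1 (hlt k)
  have hI : ∀ k, Tendsto (fun n => ⨅ f, Φ n f) atTop (𝓝 (φ (g k))) := fun k =>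
    tendsto_iInf_of_compactSpace hlow (hgmem k).2 (hΦ k)
  obtain ⟨ε, h0, hε, hle⟩ := exists_tendsto_zero_eventually_ge
    (δ := fun k n => (Φ n (g k)).toReal - (⨅ f, Φ n f).toReal) (fun k => by
      have ht := EReal.tendsto_toReal (hlt k).ne (hbot (g k)).ne'
      simpa using (ht.comp (hΦ k)).sub (ht.comp (hI k)))
  refine ⟨ε, h0, hε, ?_⟩
  rw [hg]
  rintro _ ⟨k, rfl⟩
  filter_upwards [hle k, (hΦ k).eventually (lt_mem_nhds (hbot _)),
    (hΦ k).eventually (gt_mem_nhds (hlt k)), (hI k).eventually (lt_mem_nhds (hbot _)),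
    (hI k).eventually (gt_mem_nhds (hlt k))] with n hn h1 h2 h3 h4
  rw [epsArgmin, mem_ofPred_eq, ← EReal.coe_toReal h2.ne h1.ne', ← EReal.coe_toReal h4.ne h3.ne',
    ← EReal.coe_add, EReal.coe_le_coe_iff]
  linarith

end Argmin

/-! ### Assembly of the main theorem. -/

theorem theorem3p4 {d d₀ : ℕ}
    (S : Set (EuclideanSpace ℝ (Fin d))) (hS : IsClosed S) (c : S × ℝ)
    (F : Set (UscFcns S c)) (hF : IsClosed F)
    (S₀ : Set (EuclideanSpace ℝ (Fin d₀))) [B : MeasurableSpace S₀]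
    (P₀ : Measure S₀) [IsProbabilityMeasure P₀] [P₀.IsComplete]
    (ψ : S₀ → F → EReal) (hψ : IsRandomLsc ψ) (hψ' : LocallyInfIntegrable P₀ ψ)
    {Ω : Type*} [MeasurableSpace Ω] (μ : Measure Ω) [IsProbabilityMeasure μ]
    (X : ℕ → Ω → S₀) (hX : IsIIDSample μ P₀ X)
    (pen : ℕ → F → ℝ≥0)
    (hpen : ∀ (u : ℕ → F) (f : F), Tendsto u atTop (𝓝 f) →
      Tendsto (fun n => pen n (u n)) atTop (𝓝 0)) :
    ∀ᵐ ω ∂μ,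
      (∀ ε : ℕ → ℝ, (∀ n, 0 ≤ ε n) → Tendsto ε atTop (𝓝 0) →
        OutLim (fun n => epsArgmin (ε n) (penalizedRisk ψ pen (fun j => X j ω) n)) ⊆
          argmin (fun f : F => extIntegral μ (fun ω' => ψ (X 0 ω') f))) ∧
      ((∃ f : F, extIntegral μ (fun ω' => ψ (X 0 ω') f) < ⊤) →
        (∃ (x : S) (α : ℝ), ∀ f ∈ F, (α : EReal) ≤ f x) →
        ∃ ε : ℕ → ℝ, (∀ n, 0 ≤ ε n) ∧ Tendsto ε atTop (𝓝 0) ∧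
          SetConverges (fun n => epsArgmin (ε n) (penalizedRisk ψ pen (fun j => X j ω) n))
            (argmin (fun f : F => extIntegral μ (fun ω' => ψ (X 0 ω') f)))) := by
  have : ProperSpace (UscFcns S c) := UscFcns.properSpace hS
  have : ProperSpace F := ProperSpace.of_isClosed hF
  have : PolishSpace F := inferInstance
  have hφ : ∀ f : F, (extIntegral μ fun ω' => ψ (X 0 ω') f) = extIntegral P₀ fun x => ψ x f :=
    fun f => hX.extIntegral_comp (hψ.measurable_section f) 0
  simp only [hφ]
  obtain ⟨D, hDc, hD, hDd⟩ := exists_countable_minimizing fun f : F => extIntegral P₀ fun x => ψ x f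
  have hup : ∀ᵐ ω ∂μ, ∀ g ∈ D, (extIntegral P₀ fun x => ψ x g) < ⊤ →
      Tendsto (fun n => penalizedRisk ψ pen (fun j => X j ω) n g) atTop
        (𝓝 (extIntegral P₀ fun x => ψ x g)) :=
    (ae_ball_iff hDc).2 fun g _ => eventually_imp_distrib_left.2 fun hg =>
      ae_tendsto_penalizedRisk hψ hψ' hX (hpen _ g tendsto_const_nhds) hg
  filter_upwards [ae_forall_exists_nhds_lt_penalizedRisk hψ hψ' hX pen, hup] with ω hlow hupω
  refine ⟨fun ε _ hε => outLim_epsArgmin_subset hlow hD hupω hε, fun hfin ⟨x, α, hα⟩ => ?_⟩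
  have : CompactSpace F :=
    isCompact_iff_compactSpace.1 (UscFcns.isCompact_of_common_minorant hS hF hα)
  exact exists_setConverges_epsArgmin hlow hDc hD hDd hupω
    (fun f => bot_lt_extIntegral (hψ'.lintegral_neg_lt_top f)) hfin
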